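/- Let $g(x) = (1+e^{-x})^{-1}$, applied entrywise to matrices, and for $C_n > 0$ let $\mathcal K_n = \{M \in \mathbb R^{n\times n} : \|M\|_* \le C_n n,\ M = -M^\top\}$, where $\|\cdot\|_*$ is the nuclear norm. For $M \in \mathcal K_n$ the data $Y = (y_{ij})_{n\times n}$ are generated as follows. The numbers of comparisons $n_{ij} = n_{ji}$, $1 \le i < j \le n$, are independent with $n_{ij} \sim \mathrm{Binomial}(T, p_{ij,n})$, where $T \ge 1$ is an integer, $p_{ij,n} = p_{ji,n}$ and $p_{ij,n} \in [p_n, q_n]$ for all $i \ne j$, with $0 \le p_n \le q_n \le 1$. Given the $n_{ij}$, the $y_{ij}$, $i<j$, are independent with $y_{ij} \sim \mathrm{Binomial}(n_{ij}, g(m_{ij}))$, and $y_{ji} = n_{ij} - y_{ij}$. There are absolute constants $\kappa_3, \kappa_4, \kappa_5 > 0$ and $N$ such that the following holds for all $T \ge 1$ and all $c_1, c_2 > 0$. Let $n > N$, suppose that $p_n \ge c_1 q_n$ and $p_n \ge c_2 \log(n)/n$, and that $$12 \le C_n^2 \le \min\{1, \kappa_3^2/T\}\, n .$$ Then for every (possibly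 randomized) estimator $\hat M = \hat M(Y) \in \mathbb R^{n \times n}$, which may depend on $n$, $C_n$, $T$ and the $p_{ij,n}$, there is an $M \in \mathcal K_n$ such that, when the data are generated from $M$, with probability at least $3/8$, $$\frac{1}{n^2-n}\,\|g(M) - g(\hat M)\|_F^2 \ \ge\ \min\left\{\kappa_4,\ \kappa_5 \sqrt{\frac{c_1}{T}}\; C_n \sqrt{\frac{1}{n p_n}}\right\}.$$ -/

import Mathlib

open MeasureTheory ProbabilityTheory

namespace PairwiseComparison

/-- Unordered pairs of distinct subjects, each represented by `(i, j)` with `i < j`. -/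
abbrev Pair (n : ℕ) : Type := {e : Fin n × Fin n // e.1 < e.2}

/-- The nuclear norm: the sum of the singular values (with multiplicity) of `M`. -/
noncomputable def nuclearNorm {n : ℕ} (M : Matrix (Fin n) (Fin n) ℝ) : ℝ :=
  ∑ k ∈ Finset.range n, (Matrix.toEuclideanLin M).singularValues k

/-- The parameter space: real skew-symmetric `n × n` matrices `M` with `‖M‖_* ≤ C n`. -/
def parameterSpace (n : ℕ) (C : ℝ) : Set (Matrix (Fin n) (Fin n) ℝ) :=
  {M | nuclearNorm M ≤ C * n ∧ M = -M.transpose}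

/-- The law of the numbers of comparisons `n_{ij}`, `i < j`: independent `Binomial(T, p_{ij})`. -/
noncomputable def countLaw {n : ℕ} (T : ℕ) (p : Fin n → Fin n → unitInterval) :
    Measure (Pair n → ℕ) :=
  Measure.pi fun e => binomial T (p e.1.1 e.1.2)

/-- The conditional law, given the numbers of comparisons `N`, of the numbers of wins `y_{ij}`
of `i` over `j`, `i < j`: independent `Binomial(n_{ij}, g(m_{ij}))` with `g` the logistic
function. -/
noncomputable def winLaw {n : ℕ} (N : Pair n → ℕ) (M : Matrix (Fin n) (Fin n) ℝ) :
    Measure (Pair n → ℕ) :=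
  Measure.pi fun e => binomial (N e) (unitInterval.sigmoid (M e.1.1 e.1.2))

/-- The table `Y` of results: `y_{ij}` is the number of wins of `i` over `j`, and
`y_{ji} = n_{ij} - y_{ij}`. (Under `winLaw N M` we have `W ≤ N` almost surely, so that the
subtraction does not truncate.) The diagonal, where nothing is observed, is `0`. -/
def resultTable {n : ℕ} (N W : Pair n → ℕ) : Fin n → Fin n → ℕ := fun i j =>
  if h : i < j then W ⟨(i, j), h⟩
  else if h : j < i then N ⟨(j, i), h⟩ - W ⟨(j, i), h⟩
  else 0

/-- The law of the data `Y` when the true parameter is `M`. -/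
noncomputable def dataLaw {n : ℕ} (T : ℕ) (p : Fin n → Fin n → unitInterval)
    (M : Matrix (Fin n) (Fin n) ℝ) : Measure (Fin n → Fin n → ℕ) :=
  (countLaw T p).bind fun N => (winLaw N M).map (resultTable N)

open scoped Matrix.Norms.Frobenius in
/-- The normalized squared Frobenius error `‖g(M) - g(M')‖_F² / (n² - n)`, with the logistic
function `g` applied entrywise. -/
noncomputable def loss {n : ℕ} (M M' : Matrix (Fin n) (Fin n) ℝ) : ℝ :=
  1 / ((n : ℝ) ^ 2 - n) * ‖M.map Real.sigmoid - M'.map Real.sigmoid‖ ^ 2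

end PairwiseComparison

/-!
The proof is Assouad's method over a hypercube of low-rank skew-symmetric matrices.

Split the indices into `r` blocks of `s` columns and the remaining rows, and give every pair
(row `i`, block `k`) a free sign: the entries of row `i` in block `k` equal `γ` or `-γ`, and skew
symmetry fills in the mirror image (`signMatrix`). Such a matrix has rank at most `2 * r` and entries
at most `γ`, so by Cauchy–Schwarz for singular values (`nuclearNorm_le_sqrt_rank_mul`) its nuclear
norm is at most `√(2 * r) * γ * n`, hence it lies in the parameter space when
`2 * r * γ ^ 2 ≤ C ^ 2`.

A single sign is observed only through `s ≈ n / (2 * r)` pairs, with at most `T * q` comparisons each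
on average. The chi-square bound `abs_dataLaw_bind_sub_le` shows that flipping it changes the
probability of any event about the estimator by at most `1 / 8`, as soon as `r` is a large multiple
of `T * q * n * γ ^ 2`. Assouad's lemma `exists_le_measureReal_card_errors` then gives a sign pattern
for which, with probability at least `3 / 8`, a fixed fraction of the signs is decoded wrongly from
the estimate. The number of errors is bounded by the number of signs, so the bound on its expectation
already yields a bound in probability, and neither a packing nor Fano's inequality is needed. Every
wrong sign costs a squared error of order `s * γ ^ 2`, so the normalized loss is of order `γ ^ 2`.

The two conditions on `r` and `γ` are compatible for `γ ^ 2` of order `C / √(T * q * n)` (and at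
most `1`), which is at least of the order of the claimed rate since `c₁ * q ≤ p`. The upper bound on
`C ^ 2` ensures `2 * r ≤ n`.
-/

namespace PairwiseComparison

/-! ### Chi-square comparison of binomial laws -/

lemma integral_id_binomial (n : ℕ) (p : unitInterval) :
    ∫ k, (k : ℝ) ∂(binomial n p) = n * p := by
  rw [integral_binomial, ← Nat.range_succ_eq_Iic]
  have h := congrArg (Polynomial.eval (p : ℝ)) (bernsteinPolynomial.sum_smul ℝ n)
  simp only [Polynomial.eval_finsetSum, bernsteinPolynomial, Polynomial.eval_mul,
    Polynomial.eval_pow, Polynomial.eval_sub, Polynomial.eval_X, Polynomial.eval_one,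
    Polynomial.eval_natCast, nsmul_eq_mul] at h
  rw [← h]
  refine Finset.sum_congr rfl fun k _ => ?_
  simp only [smul_eq_mul]; ring

/-- The likelihood ratio of `Binomial(N, v)` with respect to `Binomial(N, u)` at `k`. It is the
density only for `0 < u < 1`, where no division by zero occurs; its values at `k > N` are immaterial,
as these `k` have measure zero. -/
noncomputable def likelihoodRatio (N : ℕ) (u v : unitInterval) (k : ℕ) : ℝ :=
  ((v : ℝ) / u) ^ k * ((1 - v) / (1 - u)) ^ (N - k)

lemma likelihoodRatio_nonneg (N : ℕ) (u v : unitInterval) (k : ℕ) :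
    0 ≤ likelihoodRatio N u v k :=
  mul_nonneg (pow_nonneg (div_nonneg v.2.1 u.2.1) _)
    (pow_nonneg (div_nonneg (sub_nonneg.2 v.2.2) (sub_nonneg.2 u.2.2)) _)

lemma binomial_singleton_eq_mul_likelihoodRatio (N : ℕ) {u : unitInterval} (v : unitInterval)
    (h0 : 0 < (u : ℝ)) (h1 : (u : ℝ) < 1) (k : ℕ) :
    binomial N v {k} = binomial N u {k} * ENNReal.ofReal (likelihoodRatio N u v k) := by
  have h1' : (1 : ℝ) - u ≠ 0 := by linarith
  rw [binomial_singleton, binomial_singleton, ← ENNReal.ofReal_mul binomial_nonneg]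
  congr 1
  simp only [likelihoodRatio, div_pow]
  field_simp

lemma pi_binomial_withDensity {ι : Type*} [Fintype ι] (N : ι → ℕ) {u : ι → unitInterval}
    (v : ι → unitInterval) (h0 : ∀ e, 0 < (u e : ℝ)) (h1 : ∀ e, (u e : ℝ) < 1) :
    (Measure.pi fun e => binomial (N e) (u e)).withDensity
        (fun w => ENNReal.ofReal (∏ e, likelihoodRatio (N e) (u e) (v e) (w e))) =
      Measure.pi fun e => binomial (N e) (v e) := by
  refine Measure.ext_of_singleton fun w => ?_
  rw [withDensity_apply _ (measurableSet_singleton _), Measure.restrict_singleton,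
    lintegral_smul_measure, lintegral_dirac, Measure.pi_singleton, Measure.pi_singleton,
    ENNReal.ofReal_prod_of_nonneg fun e _ => likelihoodRatio_nonneg _ _ _ _, smul_eq_mul,
    ← Finset.prod_mul_distrib]
  exact Finset.prod_congr rfl fun e _ =>
    (binomial_singleton_eq_mul_likelihoodRatio _ _ (h0 e) (h1 e) _).symm

/-- The second moment of the likelihood ratio, `1 + χ²` with the chi-square divergence `χ²`:
one factor for each of the `N` trials. -/
lemma integral_sq_likelihoodRatio (N : ℕ) {u : unitInterval} (v : unitInterval)
    (h0 : 0 < (u : ℝ)) (h1 : (u : ℝ) < 1) :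
    ∫ k, likelihoodRatio N u v k ^ 2 ∂(binomial N u) =
      (1 + ((v : ℝ) - u) ^ 2 / (u * (1 - u))) ^ N := by
  have h1' : (1 : ℝ) - u ≠ 0 := by linarith
  have h2 : 1 + ((v : ℝ) - u) ^ 2 / (u * (1 - u)) = v ^ 2 / u + (1 - v) ^ 2 / (1 - u) := by
    field_simp; ring
  rw [h2, add_pow, integral_binomial, ← Nat.range_succ_eq_Iic]
  refine Finset.sum_congr rfl fun k _ => ?_
  simp only [smul_eq_mul, likelihoodRatio, div_pow]
  generalize (1 : ℝ) - v = y
  field_simp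
  ring

/-- A two-point bound for products of binomial laws: the expectations of a `[0, 1]`-valued
statistic under the two laws differ by at most `a / 2 + S / a`, where `S` is the sum of the
chi-square divergences of the underlying Bernoulli trials. If `S ≤ 1` this is Cauchy–Schwarz for
the likelihood ratio, in the form `|x| ≤ a / 2 + x ^ 2 / (2 * a)`; otherwise the right-hand side
exceeds `1`. As the bound is affine in the numbers of trials `N`, it can be averaged over random
`N`. -/
lemma abs_integral_sub_le {ι : Type*} [Fintype ι] (N : ι → ℕ) {u : ι → unitInterval}
    (v : ι → unitInterval) (h0 : ∀ e, 0 < (u e : ℝ)) (h1 : ∀ e, (u e : ℝ) < 1)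
    {f : (ι → ℕ) → ℝ} (f0 : ∀ w, 0 ≤ f w) (f1 : ∀ w, f w ≤ 1) {a : ℝ} (ha : 0 < a) (ha1 : a ≤ 1) :
    |∫ w, f w ∂(Measure.pi fun e => binomial (N e) (v e)) -
        ∫ w, f w ∂(Measure.pi fun e => binomial (N e) (u e))| ≤
      a / 2 + (∑ e, N e * (((v e : ℝ) - u e) ^ 2 / (u e * (1 - u e)))) / a := by
  set S := ∑ e, N e * (((v e : ℝ) - u e) ^ 2 / (u e * (1 - u e))) with hS
  set P := Measure.pi fun e => binomial (N e) (u e) with hP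
  have hf : ∀ (Q : Measure (ι → ℕ)) [IsProbabilityMeasure Q],
      Integrable f Q ∧ 0 ≤ ∫ w, f w ∂Q ∧ ∫ w, f w ∂Q ≤ 1 := fun Q _ => by
    have hi : Integrable f Q := Integrable.of_bound (C := 1)
      (Measurable.of_discrete).aestronglyMeasurable
      (Filter.Eventually.of_forall fun w => by rw [Real.norm_eq_abs, abs_of_nonneg (f0 w)]; exact f1 w)
    refine ⟨hi, integral_nonneg f0, ?_⟩
    calc ∫ w, f w ∂Q ≤ ∫ w, (1 : ℝ) ∂Q := integral_mono hi (integrable_const _) f1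
      _ = 1 := by simp
  by_cases hS1 : S ≤ 1
  swap
  · have hS1' : 1 < S := not_le.1 hS1
    have : 1 ≤ S / a := by rw [le_div_iff₀ ha]; linarith
    obtain ⟨-, b1, b2⟩ := hf P
    obtain ⟨-, b3, b4⟩ := hf (Measure.pi fun e => binomial (N e) (v e))
    rw [abs_le]; constructor <;> linarith
  set Λ : (ι → ℕ) → ℝ := fun w => ∏ e, likelihoodRatio (N e) (u e) (v e) (w e) with hΛ
  have hΛ0 : ∀ w, 0 ≤ Λ w := fun w => Finset.prod_nonneg fun e _ => likelihoodRatio_nonneg _ _ _ _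
  have hQ := pi_binomial_withDensity N v h0 h1
  have hΛi : Integrable Λ P := Integrable.fintype_prod fun e => integrable_binomial _
  have hΛ2i : Integrable (fun w => Λ w ^ 2) P := by
    simp only [hΛ, ← Finset.prod_pow]
    exact Integrable.fintype_prod (f := fun e k => likelihoodRatio (N e) (u e) (v e) k ^ 2)
      fun e => integrable_binomial _
  have hchange : ∀ h : (ι → ℕ) → ℝ,
      ∫ w, h w ∂(Measure.pi fun e => binomial (N e) (v e)) = ∫ w, Λ w * h w ∂P := fun h => by
    rw [← hQ, integral_withDensity_eq_integral_toReal_smul Measurable.of_discrete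
      (Filter.Eventually.of_forall fun w => ENNReal.ofReal_lt_top)]
    refine integral_congr_ae (Filter.Eventually.of_forall fun w => ?_)
    simp only [smul_eq_mul]
    rw [ENNReal.toReal_ofReal (hΛ0 w)]
  have hΛ1 : ∫ w, Λ w ∂P = 1 := by
    have := hchange fun _ => 1
    simpa using this.symm
  have hΛ2 : ∫ w, Λ w ^ 2 ∂P ≤ 1 + 2 * S := by
    have e1 : ∫ w, Λ w ^ 2 ∂P = ∏ e, (1 + ((v e : ℝ) - u e) ^ 2 / (u e * (1 - u e))) ^ N e := by
      simp only [hΛ, ← Finset.prod_pow]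
      rw [hP, integral_fintype_prod_eq_prod
        (fun e k => likelihoodRatio (N e) (u e) (v e) k ^ 2)]
      exact Finset.prod_congr rfl fun e _ => integral_sq_likelihoodRatio _ _ (h0 e) (h1 e)
    have hχ : ∀ e, 0 ≤ ((v e : ℝ) - u e) ^ 2 / (u e * (1 - u e)) := fun e =>
      div_nonneg (sq_nonneg _) (mul_nonneg (h0 e).le (by linarith [h1 e]))
    have hS0 : 0 ≤ S := Finset.sum_nonneg fun e _ => mul_nonneg (Nat.cast_nonneg _) (hχ e)
    have e2 : ∫ w, Λ w ^ 2 ∂P ≤ Real.exp S := by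
      rw [e1, hS, Real.exp_sum]
      refine Finset.prod_le_prod (fun e _ => pow_nonneg (by linarith [hχ e]) _) fun e _ => ?_
      rw [Real.exp_nat_mul]
      have h2 := Real.add_one_le_exp (((v e : ℝ) - u e) ^ 2 / (u e * (1 - u e)))
      exact pow_le_pow_left₀ (by linarith [hχ e]) (by linarith) _
    have e3 := Real.abs_exp_sub_one_le (x := S) (by rw [abs_of_nonneg hS0]; exact hS1)
    rw [abs_of_nonneg hS0] at e3
    linarith [le_abs_self (Real.exp S - 1)]
  have hdi : Integrable (fun w => Λ w ^ 2 - 2 * Λ w) P := hΛ2i.sub (hΛi.const_mul 2)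
  have hd2i : Integrable (fun w => Λ w ^ 2 - 2 * Λ w + 1) P := hdi.add (integrable_const _)
  have hd2 : ∫ w, (Λ w ^ 2 - 2 * Λ w + 1) ∂P ≤ 2 * S := by
    rw [integral_add hdi (integrable_const _),
      integral_sub hΛ2i (hΛi.const_mul 2), integral_const_mul, hΛ1]
    simp; linarith
  have hΛf : Integrable (fun w => Λ w * f w) P :=
    hΛi.mul_bdd (c := 1) (Measurable.of_discrete).aestronglyMeasurable
      (Filter.Eventually.of_forall fun w => by
        rw [Real.norm_eq_abs, abs_of_nonneg (f0 w)]; exact f1 w)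
  rw [hchange, ← integral_sub hΛf (hf P).1, ← Real.norm_eq_abs]
  refine (norm_integral_le_of_norm_le
    (g := fun w => a / 2 + (2 * a)⁻¹ * (Λ w ^ 2 - 2 * Λ w + 1))
    ((integrable_const _).add (hd2i.const_mul _))
    (Filter.Eventually.of_forall fun w => ?_)).trans ?_
  · have e1 : Λ w * f w - f w = (Λ w - 1) * f w := by ring
    rw [e1, Real.norm_eq_abs, abs_mul, abs_of_nonneg (f0 w)]
    have e2 : |Λ w - 1| * f w ≤ |Λ w - 1| := mul_le_of_le_one_right (abs_nonneg _) (f1 w)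
    have e3 : a / 2 + (2 * a)⁻¹ * (Λ w ^ 2 - 2 * Λ w + 1) - |Λ w - 1| =
        (2 * a)⁻¹ * (a - |Λ w - 1|) ^ 2 := by
      have : Λ w ^ 2 - 2 * Λ w + 1 = |Λ w - 1| ^ 2 := by rw [sq_abs]; ring
      rw [this]; field_simp; ring
    have e4 : 0 ≤ (2 * a)⁻¹ * (a - |Λ w - 1|) ^ 2 := by positivity
    linarith
  · rw [integral_add (integrable_const _) (hd2i.const_mul _), integral_const_mul]
    have e5 : (2 * a)⁻¹ * ∫ w, (Λ w ^ 2 - 2 * Λ w + 1) ∂P ≤ (2 * a)⁻¹ * (2 * S) :=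
      mul_le_mul_of_nonneg_left hd2 (by positivity)
    have e6 : (2 * a)⁻¹ * (2 * S) = S / a := by field_simp
    rw [integral_const, probReal_univ, one_smul]
    linarith

/-! ### The law of an estimator -/

instance {n : ℕ} (T : ℕ) (p : Fin n → Fin n → unitInterval) :
    IsProbabilityMeasure (countLaw T p) := by unfold countLaw; infer_instance

instance {n : ℕ} (N : Pair n → ℕ) (M : Matrix (Fin n) (Fin n) ℝ) :
    IsProbabilityMeasure (winLaw N M) := by unfold winLaw; infer_instance

instance {n : ℕ} (T : ℕ) (p : Fin n → Fin n → unitInterval) (M : Matrix (Fin n) (Fin n) ℝ) :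
    IsProbabilityMeasure (dataLaw T p M) := by
  refine isProbabilityMeasure_bind Measurable.of_discrete.aemeasurable
    (Filter.Eventually.of_forall fun N => ?_)
  exact Measure.isProbabilityMeasure_map Measurable.of_discrete.aemeasurable

lemma dataLaw_bind_real {Ω : Type*} [MeasurableSpace Ω] {n : ℕ} (T : ℕ)
    (p : Fin n → Fin n → unitInterval)
    (M : Matrix (Fin n) (Fin n) ℝ) (κ : Kernel (Fin n → Fin n → ℕ) Ω) [IsMarkovKernel κ]
    {S : Set Ω} (hS : MeasurableSet S) :
    ((dataLaw T p M).bind κ).real S =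
      ∫ N, ∫ W, (κ (resultTable N W)).real S ∂(winLaw N M) ∂(countLaw T p) := by
  have h1 : ∀ N, ∫ W, (κ (resultTable N W)).real S ∂(winLaw N M) =
      (∫⁻ W, κ (resultTable N W) S ∂(winLaw N M)).toReal := fun N =>
    integral_toReal Measurable.of_discrete.aemeasurable
      (Filter.Eventually.of_forall fun W => measure_lt_top _ _)
  simp_rw [h1]
  rw [integral_toReal Measurable.of_discrete.aemeasurable, measureReal_def,
    Measure.bind_apply hS κ.measurable.aemeasurable, dataLaw,
    Measure.lintegral_bind Measurable.of_discrete.aemeasurable Measurable.of_discrete.aemeasurable]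
  · congr 1
    refine lintegral_congr fun N => ?_
    exact lintegral_map Measurable.of_discrete Measurable.of_discrete
  · refine Filter.Eventually.of_forall fun N => ?_
    calc ∫⁻ W, κ (resultTable N W) S ∂(winLaw N M) ≤ ∫⁻ W, 1 ∂(winLaw N M) :=
          lintegral_mono fun W => prob_le_one
      _ < ⊤ := by simp

/-- The two-point bound for the output of a randomized estimator, obtained by averaging
`abs_integral_sub_le` over the numbers of comparisons, whose means are `T * p i j`. -/
lemma abs_dataLaw_bind_sub_le {Ω : Type*} [MeasurableSpace Ω] {n : ℕ} (T : ℕ)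
    (p : Fin n → Fin n → unitInterval)
    (M M' : Matrix (Fin n) (Fin n) ℝ) (κ : Kernel (Fin n → Fin n → ℕ) Ω) [IsMarkovKernel κ]
    {S : Set Ω} (hS : MeasurableSet S) {a : ℝ} (ha : 0 < a) (ha1 : a ≤ 1) :
    |((dataLaw T p M').bind κ).real S - ((dataLaw T p M).bind κ).real S| ≤
      a / 2 + (∑ e : Pair n, T * (p e.1.1 e.1.2 : ℝ) *
        ((Real.sigmoid (M' e.1.1 e.1.2) - Real.sigmoid (M e.1.1 e.1.2)) ^ 2 /
          (Real.sigmoid (M e.1.1 e.1.2) * (1 - Real.sigmoid (M e.1.1 e.1.2))))) / a := by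
  set χ : Pair n → ℝ := fun e =>
    (Real.sigmoid (M' e.1.1 e.1.2) - Real.sigmoid (M e.1.1 e.1.2)) ^ 2 /
      (Real.sigmoid (M e.1.1 e.1.2) * (1 - Real.sigmoid (M e.1.1 e.1.2))) with hχ
  have hint : ∀ A : Matrix (Fin n) (Fin n) ℝ, Integrable
      (fun N => ∫ W, (κ (resultTable N W)).real S ∂(winLaw N A)) (countLaw T p) := fun A =>
    Integrable.of_bound (C := 1) (Measurable.of_discrete).aestronglyMeasurable
      (Filter.Eventually.of_forall fun N => by
        refine (norm_integral_le_of_norm_le_const (C := 1)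
          (Filter.Eventually.of_forall fun W => ?_)).trans (by simp)
        rw [Real.norm_eq_abs, abs_of_nonneg measureReal_nonneg]
        exact measureReal_le_one)
  have hi : ∀ e : Pair n, Integrable (fun N : Pair n → ℕ => (N e : ℝ) * χ e) (countLaw T p) :=
    fun e => (integrable_comp_eval (μ := fun e : Pair n => binomial T (p e.1.1 e.1.2))
      (f := fun k : ℕ => (k : ℝ)) (integrable_binomial _)).mul_const _
  have hm : ∀ e : Pair n, ∫ N, (N e : ℝ) * χ e ∂(countLaw T p) = T * (p e.1.1 e.1.2 : ℝ) * χ e :=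
    fun e => by
      rw [integral_mul_const, countLaw, integral_comp_eval
        (μ := fun e : Pair n => binomial T (p e.1.1 e.1.2)) (f := fun k : ℕ => (k : ℝ))
        (Measurable.of_discrete).aestronglyMeasurable, integral_id_binomial]
  have hsum : Integrable (fun N : Pair n → ℕ => ∑ e, (N e : ℝ) * χ e) (countLaw T p) :=
    integrable_finsetSum _ fun e _ => hi e
  rw [dataLaw_bind_real T p M' κ hS, dataLaw_bind_real T p M κ hS,
    ← integral_sub (hint M') (hint M), ← Real.norm_eq_abs]
  refine (norm_integral_le_of_norm_le
    (g := fun N : Pair n → ℕ => a / 2 + (∑ e, (N e : ℝ) * χ e) / a)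
    ((integrable_const _).add (hsum.div_const _))
    (Filter.Eventually.of_forall fun N => ?_)).trans (le_of_eq ?_)
  · exact abs_integral_sub_le N (u := fun e => unitInterval.sigmoid (M e.1.1 e.1.2))
      (fun e => unitInterval.sigmoid (M' e.1.1 e.1.2)) (fun e => Real.sigmoid_pos _)
      (fun e => Real.sigmoid_lt_one _) (fun W => measureReal_nonneg)
      (fun W => measureReal_le_one) ha ha1
  · rw [integral_add (integrable_const _) (hsum.div_const _), integral_const, probReal_univ,
      one_smul, integral_div, integral_finsetSum _ fun e _ => hi e]
    simp only [hm]
    simp only [hχ]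

/-! ### Assouad's lemma -/

/-- Assouad's lemma, in probability. If flipping a coordinate `k ∈ K` of `θ` changes the
probability of the event `E k` (decide that `θ k = true`) by at most `1 / 8`, then for some `θ`, with
probability at least `3 / 8`, at least `1 / 16` of the decisions are wrong. On average over `θ` each
decision errs with probability at least `(1 - 1 / 8) / 2 = 7 / 16`, and since the number of errors
never exceeds `#K`, the proportion exceeds `1 / 16` with probability at least `7 / 16 - 1 / 16`. -/
lemma exists_le_measureReal_card_errors {ι Ω : Type*} [Fintype ι] [DecidableEq ι]
    [MeasurableSpace Ω] (K : Finset ι) (hK : K.Nonempty) (ν : (ι → Bool) → Measure Ω)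
    [∀ θ, IsProbabilityMeasure (ν θ)] (E : ι → Set Ω) (hE : ∀ k, MeasurableSet (E k))
    (hν : ∀ θ, ∀ k ∈ K, |(ν (Function.update θ k (!θ k))).real (E k) - (ν θ).real (E k)| ≤ 1 / 8) :
    ∃ θ : ι → Bool, (3 : ℝ) / 8 ≤ (ν θ).real
      {ω | (K.card : ℝ) / 16 ≤ ∑ k ∈ K, {ω | ¬(ω ∈ E k ↔ θ k = true)}.indicator 1 ω} := by
  set F : (ι → Bool) → ι → Set Ω := fun θ k => {ω | ¬(ω ∈ E k ↔ θ k = true)} with hF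
  have hFE : ∀ θ k, F θ k = if θ k then (E k)ᶜ else E k := fun θ k => by
    ext ω; cases h : θ k <;> simp [hF, h]
  have hFm : ∀ θ k, MeasurableSet (F θ k) := fun θ k => by
    rw [hFE]; split_ifs; exacts [(hE k).compl, hE k]
  -- the error events of `θ` and of its flip are complementary
  have hflip : ∀ θ, ∀ k ∈ K,
      7 / 8 ≤ (ν θ).real (F θ k) +
        (ν (Function.update θ k (!θ k))).real (F (Function.update θ k (!θ k)) k) := by
    intro θ k hk
    have h1 := abs_le.1 (hν θ k hk)
    rw [hFE, hFE]
    cases h : θ k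
    · simp only [h, Function.update_self, Bool.not_false, if_true, Bool.false_eq_true, if_false]
        at h1 ⊢
      rw [probReal_compl_eq_one_sub (hE k)]; linarith [h1.1, h1.2]
    · simp only [h, Function.update_self, Bool.not_true, if_true, Bool.false_eq_true, if_false]
        at h1 ⊢
      rw [probReal_compl_eq_one_sub (hE k)]; linarith [h1.1, h1.2]
  have hsum : ∀ k ∈ K, ∑ _θ : ι → Bool, (7 : ℝ) / 16 ≤ ∑ θ, (ν θ).real (F θ k) := by
    intro k hk
    have hinv : Function.Involutive fun θ : ι → Bool => Function.update θ k (!θ k) := fun θ => by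
      simp
    have h2 : ∑ θ, (ν (Function.update θ k (!θ k))).real (F (Function.update θ k (!θ k)) k) =
        ∑ θ, (ν θ).real (F θ k) :=
      Equiv.sum_comp hinv.toPerm fun θ => (ν θ).real (F θ k)
    have h3 : ∑ _θ : ι → Bool, (7 : ℝ) / 8 ≤ ∑ θ, ((ν θ).real (F θ k) +
        (ν (Function.update θ k (!θ k))).real (F (Function.update θ k (!θ k)) k)) :=
      Finset.sum_le_sum fun θ _ => hflip θ k hk
    rw [Finset.sum_add_distrib, h2] at h3
    have h4 : ∑ _θ : ι → Bool, (7 : ℝ) / 8 = 2 * ∑ _θ : ι → Bool, (7 : ℝ) / 16 := by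
      rw [Finset.mul_sum]; norm_num
    linarith
  obtain ⟨θ, -, hθ⟩ : ∃ θ ∈ (Finset.univ : Finset (ι → Bool)),
      ∑ _k ∈ K, (7 : ℝ) / 16 ≤ ∑ k ∈ K, (ν θ).real (F θ k) := by
    refine Finset.exists_le_of_sum_le Finset.univ_nonempty ?_
    rw [Finset.sum_comm, Finset.sum_comm (s := Finset.univ) (t := K)
      (f := fun θ k => (ν θ).real (F θ k))]
    exact Finset.sum_le_sum hsum
  refine ⟨θ, ?_⟩
  set H : Ω → ℝ := fun ω => ∑ k ∈ K, (F θ k).indicator 1 ω with hH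
  have hHm : Measurable H :=
    Finset.measurable_sum _ fun k _ => measurable_one.indicator (hFm θ k)
  have hiF : ∀ k, Integrable ((F θ k).indicator (1 : Ω → ℝ)) (ν θ) := fun k =>
    (integrable_const (1 : ℝ)).indicator (hFm θ k)
  have hHi : Integrable H (ν θ) := integrable_finsetSum _ fun k _ => hiF k
  set G : Set Ω := {ω | (K.card : ℝ) / 16 ≤ H ω} with hG
  have hGm : MeasurableSet G := measurableSet_le measurable_const hHm
  have hiG : Integrable (G.indicator (1 : Ω → ℝ)) (ν θ) :=
    (integrable_const (1 : ℝ)).indicator hGm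
  have hHint : ∫ ω, H ω ∂(ν θ) = ∑ k ∈ K, (ν θ).real (F θ k) := by
    rw [integral_finsetSum _ fun k _ => hiF k]
    exact Finset.sum_congr rfl fun k _ => integral_indicator_one (hFm θ k)
  have hbound : ∫ ω, H ω ∂(ν θ) ≤ K.card / 16 + K.card * (ν θ).real G := by
    calc ∫ ω, H ω ∂(ν θ)
        ≤ ∫ ω, ((K.card : ℝ) / 16 + K.card * G.indicator (1 : Ω → ℝ) ω) ∂(ν θ) := by
          refine integral_mono hHi ((integrable_const _).add (hiG.const_mul _)) fun ω => ?_
          by_cases hω : ω ∈ G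
          · have : H ω ≤ ∑ _k ∈ K, (1 : ℝ) := Finset.sum_le_sum fun k _ =>
              Set.indicator_le_self' (fun _ _ => zero_le_one) ω
            simp only [Finset.sum_const, nsmul_eq_mul, mul_one] at this
            simp only [Set.indicator_of_mem hω, Pi.one_apply, mul_one]
            have h0 : (0 : ℝ) ≤ K.card := Nat.cast_nonneg _
            linarith
          · simp only [Set.indicator_of_notMem hω, mul_zero, add_zero]
            exact (not_le.1 hω).le
      _ = _ := by
          rw [integral_add (integrable_const _) (hiG.const_mul _), integral_const_mul,
            integral_indicator_one hGm, integral_const, probReal_univ, one_smul]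
  rw [hHint] at hbound
  have hK0 : (0 : ℝ) < K.card := Nat.cast_pos.2 hK.card_pos
  simp only [Finset.sum_const, nsmul_eq_mul] at hθ
  have : (K.card : ℝ) * (3 / 8) ≤ K.card * (ν θ).real G := by linarith
  exact le_of_mul_le_mul_left this hK0

/-! ### The nuclear norm and the loss -/

lemma sum_sq_singularValues {n : ℕ} (M : Matrix (Fin n) (Fin n) ℝ) :
    ∑ k ∈ Finset.range n, (Matrix.toEuclideanLin M).singularValues k ^ 2 =
      ∑ i, ∑ j, M i j ^ 2 := by
  set A := Matrix.toEuclideanLin M with hA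
  have hn : Module.finrank ℝ (EuclideanSpace ℝ (Fin n)) = n := by simp
  rw [Finset.sum_range]
  simp_rw [A.sq_singularValues_fin hn]
  have h1 := A.isSymmetric_adjoint_comp_self.trace_eq_sum_eigenvalues hn
  simp only [RCLike.ofReal_real_eq_id, id] at h1
  rw [← h1, LinearMap.trace_eq_sum_inner _ (EuclideanSpace.basisFun (Fin n) ℝ), Finset.sum_comm]
  refine Finset.sum_congr rfl fun j _ => ?_
  rw [LinearMap.comp_apply, LinearMap.adjoint_inner_right, real_inner_self_eq_norm_sq,
    EuclideanSpace.norm_sq_eq]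
  simp [hA, Matrix.toEuclideanLin]

/-- `‖M‖_* ≤ √(rank M) ‖M‖_F`: Cauchy–Schwarz for the nonzero singular values. -/
lemma nuclearNorm_le_sqrt_rank_mul {n : ℕ} (M : Matrix (Fin n) (Fin n) ℝ) :
    nuclearNorm M ≤ √(M.rank * ∑ i, ∑ j, M i j ^ 2) := by
  set A := Matrix.toEuclideanLin M with hA
  have hr : Module.finrank ℝ (LinearMap.range A) = M.rank := by
    rw [hA, Matrix.toEuclideanLin_eq_toLin_orthonormal,
      M.rank_eq_finrank_range_toLin (EuclideanSpace.basisFun (Fin n) ℝ).toBasis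
        (EuclideanSpace.basisFun (Fin n) ℝ).toBasis]
  have hrn : M.rank ≤ n := by simpa using M.rank_le_width
  have hsub : Finset.range M.rank ⊆ Finset.range n := Finset.range_subset_range.2 hrn
  refine Real.le_sqrt_of_sq_le ?_
  have h1 : nuclearNorm M = ∑ k ∈ Finset.range M.rank, A.singularValues k := by
    refine (Finset.sum_subset hsub fun k _ hk => ?_).symm
    rw [A.singularValues_eq_zero_iff_le_finrank_range, hr]
    simpa using hk
  rw [h1, ← sum_sq_singularValues]
  calc (∑ k ∈ Finset.range M.rank, A.singularValues k) ^ 2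
      ≤ (Finset.range M.rank).card * ∑ k ∈ Finset.range M.rank, A.singularValues k ^ 2 :=
        sq_sum_le_card_mul_sum_sq
    _ ≤ M.rank * ∑ k ∈ Finset.range n, A.singularValues k ^ 2 := by
        rw [Finset.card_range]
        gcongr

lemma loss_eq {n : ℕ} (M M' : Matrix (Fin n) (Fin n) ℝ) :
    loss M M' = 1 / ((n : ℝ) ^ 2 - n) *
      ∑ i, ∑ j, (Real.sigmoid (M i j) - Real.sigmoid (M' i j)) ^ 2 := by
  have h0 : 0 ≤ ∑ i, ∑ j, (Real.sigmoid (M i j) - Real.sigmoid (M' i j)) ^ 2 :=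
    Finset.sum_nonneg fun i _ => Finset.sum_nonneg fun j _ => sq_nonneg _
  rw [loss, Matrix.frobenius_norm_def, ← Real.sqrt_eq_rpow, Real.sq_sqrt]
  · simp
  · positivity

/-! ### Estimates for the logistic function -/

lemma sigmoid_sub_sigmoid_neg_le {x : ℝ} (hx : 0 ≤ x) :
    Real.sigmoid x - Real.sigmoid (-x) ≤ x := by
  rw [← Real.sigmoid_mul_rexp_neg]
  have h1 := Real.add_one_le_exp (-x)
  have h2 := Real.sigmoid_pos x
  have h3 := Real.sigmoid_lt_one x
  nlinarith

lemma le_sigmoid_sub_sigmoid_neg {x : ℝ} (hx : 0 ≤ x) (hx1 : x ≤ 1) :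
    x / 4 ≤ Real.sigmoid x - Real.sigmoid (-x) := by
  have h2 : 2⁻¹ ≤ Real.sigmoid x := by
    rw [← Real.sigmoid_zero]; exact Real.sigmoid_monotone hx
  have h1 : Real.exp (-x) ≤ 1 - x / 2 := by
    have h4 := Real.abs_exp_sub_one_sub_id_le (x := -x) (by rw [abs_neg, abs_of_nonneg hx]; exact hx1)
    have h5 := Real.exp_pos x
    rw [Real.exp_neg, inv_le_comm₀ h5 (by linarith)]
    have h6 := Real.add_one_le_exp x
    refine le_trans ?_ h6
    rw [inv_le_iff_one_le_mul₀ (by linarith)]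
    nlinarith
  rw [← Real.sigmoid_mul_rexp_neg]
  have h3 := mul_le_mul_of_nonneg_left h1 (Real.sigmoid_pos x).le
  nlinarith

lemma le_sigmoid_mul_one_sub {x : ℝ} (hx : |x| ≤ 1) :
    1 / 8 ≤ Real.sigmoid x * (1 - Real.sigmoid x) := by
  have key : ∀ y : ℝ, 0 ≤ y → y ≤ 1 → 1 / 8 ≤ Real.sigmoid y * (1 - Real.sigmoid y) := by
    intro y hy hy1
    rw [← Real.sigmoid_neg, ← Real.sigmoid_mul_rexp_neg]
    have h2 : 2⁻¹ ≤ Real.sigmoid y := by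
      rw [← Real.sigmoid_zero]; exact Real.sigmoid_monotone hy
    have h1 : Real.exp 1 * Real.exp (-1) = 1 := by rw [← Real.exp_add]; simp
    have h3 := Real.exp_one_lt_d9
    have h4 : Real.exp (-1) ≤ Real.exp (-y) := Real.exp_le_exp.2 (by linarith)
    have h5 := Real.sigmoid_mul_rexp_neg y
    rw [Real.sigmoid_neg] at h5
    have h6 := Real.exp_pos (-1)
    have h7 : (1 : ℝ) / 3 ≤ Real.exp (-1) := by nlinarith
    have h8 : Real.sigmoid y ≤ 3 / 4 := by nlinarith [Real.sigmoid_pos y]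
    rw [h5]
    nlinarith
  rcases le_total 0 x with h | h
  · exact key x h (by rwa [abs_of_nonneg h] at hx)
  · have := key (-x) (by linarith) (by rwa [abs_of_nonpos h] at hx)
    rw [Real.sigmoid_neg] at this
    linarith

/-! ### Skew-symmetric matrices built from blocks of signs -/

/-- The left factor of the low-rank matrix built from the signs `θ`: row `i` carries the signs
`θ (i, k)`, scaled by `γ`. Only the rows `i ≥ r * s` are used, so that they are disjoint from the
columns `j < r * s` selected by `blockIndicator`. -/
def signFactor {n r : ℕ} (s : ℕ) (γ : ℝ) (θ : Fin n × Fin r → Bool) :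
    Matrix (Fin n) (Fin r) ℝ :=
  Matrix.of fun i k => if r * s ≤ i then (if θ (i, k) then γ else -γ) else 0

/-- The right factor: row `k` is the indicator of the `k`-th block of `s` consecutive columns. -/
def blockIndicator (n r s : ℕ) : Matrix (Fin r) (Fin n) ℝ :=
  Matrix.of fun k j => if (j : ℕ) / s = k then 1 else 0

/-- The skew-symmetric matrix encoding the signs `θ`. For `i ≥ r * s` and `j < r * s` its `(i, j)`
entry is `γ` or `-γ` according to `θ (i, j / s)`; outside of these entries and their mirror images
it vanishes. -/
def signMatrix {n r : ℕ} (s : ℕ) (γ : ℝ) (θ : Fin n × Fin r → Bool) :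
    Matrix (Fin n) (Fin n) ℝ :=
  signFactor s γ θ * blockIndicator n r s - (signFactor s γ θ * blockIndicator n r s).transpose

section SignMatrix

variable {n r s : ℕ} {γ : ℝ} {θ : Fin n × Fin r → Bool}

lemma signFactor_mul_apply (i j : Fin n) {k : Fin r} (hk : (j : ℕ) / s = k) :
    (signFactor s γ θ * blockIndicator n r s) i j = signFactor s γ θ i k := by
  rw [Matrix.mul_apply, Finset.sum_eq_single k]
  · simp [blockIndicator, hk]
  · intro b _ hb
    have : ¬ ((k : ℕ) = b) := fun h => hb (Fin.ext h.symm)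
    simp [blockIndicator, hk, this]
  · simp

lemma signFactor_mul_apply_of_le (hs : 0 < s) (i : Fin n) {j : Fin n} (hj : r * s ≤ j) :
    (signFactor s γ θ * blockIndicator n r s) i j = 0 := by
  rw [Matrix.mul_apply]
  refine Finset.sum_eq_zero fun k _ => ?_
  have : ¬ ((j : ℕ) / s = k) := fun h =>
    absurd ((Nat.le_div_iff_mul_le hs).2 hj) (by rw [h]; exact not_le.2 k.2)
  simp [blockIndicator, this]

lemma signFactor_mul_apply_of_lt {i : Fin n} (hi : (i : ℕ) < r * s) (j : Fin n) :
    (signFactor s γ θ * blockIndicator n r s) i j = 0 := by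
  rw [Matrix.mul_apply]
  exact Finset.sum_eq_zero fun k _ => by simp [signFactor, not_le.2 hi]

lemma signMatrix_apply (hs : 0 < s) {i j : Fin n} {k : Fin r} (hi : r * s ≤ i)
    (hk : (j : ℕ) / s = k) : signMatrix s γ θ i j = if θ (i, k) then γ else -γ := by
  rw [signMatrix, Matrix.sub_apply, Matrix.transpose_apply, signFactor_mul_apply i j hk,
    signFactor_mul_apply_of_le hs j hi, sub_zero]
  simp [signFactor, hi]

lemma abs_signFactor_mul_apply_le (hs : 0 < s) (hγ : 0 ≤ γ) (i j : Fin n) :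
    |(signFactor s γ θ * blockIndicator n r s) i j| ≤ γ := by
  rcases le_or_gt (r * s) j with hj | hj
  · rw [signFactor_mul_apply_of_le hs i hj]; simpa
  · rw [signFactor_mul_apply i j (k := ⟨j / s, (Nat.div_lt_iff_lt_mul hs).2 hj⟩) rfl]
    simp only [signFactor, Matrix.of_apply]
    split_ifs <;> simp [abs_of_nonneg hγ, hγ]

lemma abs_signMatrix_apply_le (hs : 0 < s) (hγ : 0 ≤ γ) (i j : Fin n) :
    |signMatrix s γ θ i j| ≤ γ := by
  rw [signMatrix, Matrix.sub_apply, Matrix.transpose_apply]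
  rcases le_or_gt (r * s) i with hi | hi
  · rw [signFactor_mul_apply_of_le hs j hi, sub_zero]
    exact abs_signFactor_mul_apply_le hs hγ i j
  · rw [signFactor_mul_apply_of_lt hi j, zero_sub, abs_neg]
    exact abs_signFactor_mul_apply_le hs hγ j i

lemma rank_signMatrix_le : (signMatrix s γ θ).rank ≤ 2 * r := by
  have h : signMatrix s γ θ =
      Matrix.fromCols (signFactor s γ θ) (-(blockIndicator n r s).transpose) *
        Matrix.fromRows (blockIndicator n r s) (signFactor s γ θ).transpose := by
    rw [Matrix.fromCols_mul_fromRows, signMatrix, Matrix.transpose_mul, Matrix.neg_mul,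
      sub_eq_add_neg]
  rw [h]
  refine (Matrix.rank_mul_le_left _ _).trans ((Matrix.rank_le_card_width _).trans ?_)
  simp [two_mul]

lemma signMatrix_mem_parameterSpace (hs : 0 < s) (hγ : 0 ≤ γ) {C : ℝ} (hC : 0 ≤ C)
    (h : 2 * r * γ ^ 2 ≤ C ^ 2) : signMatrix s γ θ ∈ parameterSpace n C := by
  refine ⟨(nuclearNorm_le_sqrt_rank_mul _).trans (Real.sqrt_le_iff.2 ⟨by positivity, ?_⟩), ?_⟩
  · have h1 : ∑ i, ∑ j, signMatrix s γ θ i j ^ 2 ≤ n * (n * γ ^ 2) := by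
      calc ∑ i, ∑ j, signMatrix s γ θ i j ^ 2 ≤ ∑ _i : Fin n, ∑ _j : Fin n, γ ^ 2 :=
            Finset.sum_le_sum fun i _ => Finset.sum_le_sum fun j _ =>
              sq_le_sq' (abs_le.1 (abs_signMatrix_apply_le hs hγ i j)).1
                (abs_le.1 (abs_signMatrix_apply_le hs hγ i j)).2
        _ = n * (n * γ ^ 2) := by simp
    have h2 : ((signMatrix s γ θ).rank : ℝ) ≤ 2 * r := by exact_mod_cast rank_signMatrix_le
    calc ((signMatrix s γ θ).rank : ℝ) * ∑ i, ∑ j, signMatrix s γ θ i j ^ 2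
        ≤ (2 * r) * (n * (n * γ ^ 2)) := mul_le_mul h2 h1
          (Finset.sum_nonneg fun i _ => Finset.sum_nonneg fun j _ => sq_nonneg _) (by positivity)
      _ = 2 * r * γ ^ 2 * (n : ℝ) ^ 2 := by ring
      _ ≤ C ^ 2 * (n : ℝ) ^ 2 := by gcongr
      _ = (C * n) ^ 2 := by ring
  · rw [signMatrix, Matrix.transpose_sub, Matrix.transpose_transpose, neg_sub]

/-- The `k`-th block of `s` consecutive columns. -/
def columnBlock (n s : ℕ) (k : Fin r) : Finset (Fin n) :=
  Finset.univ.filter fun j => (j : ℕ) / s = k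

lemma card_columnBlock (hs : 0 < s) (hrs : r * s ≤ n) (k : Fin r) :
    (columnBlock n s k).card = s := by
  rw [columnBlock, ← Finset.card_image_of_injective _ Fin.val_injective]
  have : (Finset.univ.filter fun j : Fin n => (j : ℕ) / s = k).image Fin.val =
      Finset.Ico (k * s) (k * s + s) := by
    ext x
    simp only [Finset.mem_image, Finset.mem_filter, Finset.mem_univ, true_and, Finset.mem_Ico]
    have hd : ∀ y : ℕ, y / s = k ↔ k * s ≤ y ∧ y < k * s + s := fun y => by
      rw [Nat.div_eq_iff hs]; omega
    constructor
    · rintro ⟨j, hj, rfl⟩; exact (hd _).1 hj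
    · intro hx
      have : k * s + s ≤ r * s := by
        rw [← Nat.succ_mul]; exact Nat.mul_le_mul_right _ k.2
      exact ⟨⟨x, by omega⟩, (hd x).2 hx, rfl⟩
  rw [this]; simp

lemma card_rows (m : ℕ) : (Finset.univ.filter fun i : Fin n => m ≤ (i : ℕ)).card = n - m := by
  rw [← Finset.card_image_of_injective _ Fin.val_injective]
  have : (Finset.univ.filter fun i : Fin n => m ≤ (i : ℕ)).image Fin.val = Finset.Ico m n := by
    ext x
    simp only [Finset.mem_image, Finset.mem_filter, Finset.mem_univ, true_and, Finset.mem_Ico]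
    constructor
    · rintro ⟨j, hj, rfl⟩; exact ⟨hj, j.2⟩
    · intro hx; exact ⟨⟨x, hx.2⟩, hx.1, rfl⟩
  rw [this]; simp

/-- Flipping the sign at `(i₀, k₀)` changes, among the pairs `i < j`, only those with `j = i₀` and
`i` in the `k₀`-th block. -/
lemma signMatrix_update_apply (hs : 0 < s) {i₀ : Fin n} {k₀ : Fin r} (b : Bool) {i j : Fin n}
    (hij : i < j) (h : ¬ (j = i₀ ∧ (i : ℕ) / s = k₀)) :
    signMatrix s γ (Function.update θ (i₀, k₀) b) i j = signMatrix s γ θ i j := by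
  have key : ∀ x y : Fin n, ¬ (x = i₀ ∧ (y : ℕ) / s = k₀) →
      (signFactor s γ (Function.update θ (i₀, k₀) b) * blockIndicator n r s) x y =
        (signFactor s γ θ * blockIndicator n r s) x y := by
    intro x y hxy
    rcases le_or_gt (r * s) y with hy | hy
    · rw [signFactor_mul_apply_of_le hs x hy, signFactor_mul_apply_of_le hs x hy]
    · rw [signFactor_mul_apply x y (k := ⟨y / s, (Nat.div_lt_iff_lt_mul hs).2 hy⟩) rfl,
        signFactor_mul_apply x y (k := ⟨y / s, (Nat.div_lt_iff_lt_mul hs).2 hy⟩) rfl]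
      have hne : (x, (⟨y / s, (Nat.div_lt_iff_lt_mul hs).2 hy⟩ : Fin r)) ≠ (i₀, k₀) := fun e =>
        hxy ⟨(Prod.mk.inj e).1, congrArg Fin.val (Prod.mk.inj e).2⟩
      simp only [signFactor, Matrix.of_apply, Function.update_of_ne hne]
  rw [signMatrix, signMatrix, Matrix.sub_apply, Matrix.sub_apply, Matrix.transpose_apply,
    Matrix.transpose_apply, key j i h]
  congr 1
  rcases le_or_gt (r * s) j with hj | hj
  · rw [signFactor_mul_apply_of_le hs i hj, signFactor_mul_apply_of_le hs i hj]
  · have hi : (i : ℕ) < r * s := lt_trans hij hj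
    rw [signFactor_mul_apply_of_lt hi j, signFactor_mul_apply_of_lt hi j]

/-- One sign is seen through `s` pairs with at most `T * q` comparisons each in the mean, and each
comparison has chi-square divergence at most `8 * γ ^ 2`. The condition on `T * q * s * γ ^ 2`
makes the sign nearly undetectable. -/
lemma abs_dataLaw_signMatrix_flip_le {Ω : Type*} [MeasurableSpace Ω] (hs : 0 < s)
    (hrs : r * s ≤ n) (hγ : 0 ≤ γ) (hγ1 : γ ≤ 1) (T : ℕ) (p : Fin n → Fin n → unitInterval)
    {q : ℝ} (hq : ∀ i j, i ≠ j → (p i j : ℝ) ≤ q) (hTq : T * q * s * γ ^ 2 ≤ 1 / 1024)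
    (κ : Kernel (Fin n → Fin n → ℕ) Ω) [IsMarkovKernel κ] {S : Set Ω} (hS : MeasurableSet S)
    (x : Fin n × Fin r) (b : Bool) :
    |((dataLaw T p (signMatrix s γ (Function.update θ x b))).bind κ).real S -
      ((dataLaw T p (signMatrix s γ θ)).bind κ).real S| ≤ 1 / 8 := by
  obtain ⟨i₀, k₀⟩ := x
  refine (abs_dataLaw_bind_sub_le T p _ _ κ hS (a := 1 / 8) (by norm_num) (by norm_num)).trans ?_
  set B : Finset (Pair n) := Finset.univ.filter fun e => e.1.2 = i₀ ∧ (e.1.1 : ℕ) / s = k₀ with hB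
  have hBcard : B.card ≤ s := by
    rw [← card_columnBlock hs hrs k₀]
    refine Finset.card_le_card_of_injOn (fun e => e.1.1) (fun e he => ?_) fun e he e' he' h => ?_
    · exact Finset.mem_filter.2 ⟨Finset.mem_univ _, (Finset.mem_filter.1 he).2.2⟩
    · have h1 := (Finset.mem_filter.1 he).2.1
      have h2 := (Finset.mem_filter.1 he').2.1
      exact Subtype.ext (Prod.ext h (h1.trans h2.symm))
  have hsum : ∑ e : Pair n, T * (p e.1.1 e.1.2 : ℝ) *
        ((Real.sigmoid (signMatrix s γ (Function.update θ (i₀, k₀) b) e.1.1 e.1.2) -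
            Real.sigmoid (signMatrix s γ θ e.1.1 e.1.2)) ^ 2 /
          (Real.sigmoid (signMatrix s γ θ e.1.1 e.1.2) *
            (1 - Real.sigmoid (signMatrix s γ θ e.1.1 e.1.2)))) ≤
      ∑ e ∈ B, T * q * (8 * γ ^ 2) := by
    rw [← Finset.sum_subset (Finset.subset_univ B) fun e _ he => ?_]
    · refine Finset.sum_le_sum fun e _ => ?_
      have hbd : ∀ θ' : Fin n × Fin r → Bool,
          Real.sigmoid (-γ) ≤ Real.sigmoid (signMatrix s γ θ' e.1.1 e.1.2) ∧
            Real.sigmoid (signMatrix s γ θ' e.1.1 e.1.2) ≤ Real.sigmoid γ := fun θ' =>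
        have h := abs_le.1 (abs_signMatrix_apply_le (θ := θ') hs hγ e.1.1 e.1.2)
        ⟨Real.sigmoid_monotone h.1, Real.sigmoid_monotone h.2⟩
      have hΔ := sigmoid_sub_sigmoid_neg_le hγ
      have h1 := hbd (Function.update θ (i₀, k₀) b)
      have h2 := hbd θ
      have h3 := le_sigmoid_mul_one_sub
        ((abs_signMatrix_apply_le (θ := θ) hs hγ e.1.1 e.1.2).trans hγ1)
      have hp0 : (0 : ℝ) ≤ p e.1.1 e.1.2 := (p e.1.1 e.1.2).2.1
      have hpq := hq e.1.1 e.1.2 e.2.ne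
      refine mul_le_mul (mul_le_mul_of_nonneg_left hpq (Nat.cast_nonneg _)) ?_
        (div_nonneg (sq_nonneg _) (by linarith)) (mul_nonneg (Nat.cast_nonneg _) (hp0.trans hpq))
      rw [div_le_iff₀ (by linarith)]
      have h4 : (Real.sigmoid (signMatrix s γ (Function.update θ (i₀, k₀) b) e.1.1 e.1.2) -
            Real.sigmoid (signMatrix s γ θ e.1.1 e.1.2)) ^ 2 ≤ γ ^ 2 :=
        sq_le_sq' (by linarith) (by linarith)
      nlinarith [sq_nonneg γ]
    · rw [signMatrix_update_apply hs b e.2 fun h => he (Finset.mem_filter.2 ⟨Finset.mem_univ _, h⟩)]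
      simp
  rcases Finset.eq_empty_or_nonempty B with hB0 | ⟨e, -⟩
  · rw [hB0, Finset.sum_empty] at hsum
    linarith
  have hq0 : 0 ≤ q := (p e.1.1 e.1.2).2.1.trans (hq _ _ e.2.ne)
  rw [Finset.sum_const, nsmul_eq_mul] at hsum
  have h5 : (B.card : ℝ) * (T * q * (8 * γ ^ 2)) ≤ s * (T * q * (8 * γ ^ 2)) := by
    gcongr
  linarith

end SignMatrix

/-! ### Decoding the signs, and the lower bound -/

/-- The event that a matrix `A` of estimates, restricted to row `i` and block `k` for `x = (i, k)`,
is, after applying the logistic function, at least as close to the constant `γ` as to `-γ`. -/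
def decodedPositive {n r : ℕ} (s : ℕ) (γ : ℝ) (x : Fin n × Fin r) : Set (Fin n → Fin n → ℝ) :=
  {A | ∑ j ∈ columnBlock n s x.2, (Real.sigmoid γ - Real.sigmoid (A x.1 j)) ^ 2 ≤
    ∑ j ∈ columnBlock n s x.2, (Real.sigmoid (-γ) - Real.sigmoid (A x.1 j)) ^ 2}

lemma measurableSet_decodedPositive {n r : ℕ} (s : ℕ) (γ : ℝ) (x : Fin n × Fin r) :
    MeasurableSet (decodedPositive s γ x) := by
  have h : ∀ c : ℝ, Measurable fun A : Fin n → Fin n → ℝ =>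
      ∑ j ∈ columnBlock n s x.2, (c - Real.sigmoid (A x.1 j)) ^ 2 := fun c =>
    Finset.measurable_sum _ fun j _ => ((measurable_const.sub
      (continuous_sigmoid.measurable.comp
        ((measurable_pi_apply j).comp (measurable_pi_apply x.1)))).pow_const 2)
  exact measurableSet_le (h _) (h _)

/-- A wrongly decoded sign costs a squared error of at least a quarter of the squared distance
between the two candidate blocks, which is at least `s * (γ / 4) ^ 2`. -/
lemma le_blockError_of_decoding_error {n r s : ℕ} (hs : 0 < s) (hrs : r * s ≤ n) {γ : ℝ}
    (hγ : 0 ≤ γ) (hγ1 : γ ≤ 1) {θ : Fin n × Fin r → Bool} {x : Fin n × Fin r}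
    (hx : r * s ≤ (x.1 : ℕ)) {A : Fin n → Fin n → ℝ}
    (h : ¬ (A ∈ decodedPositive s γ x ↔ θ x = true)) :
    s * γ ^ 2 / 64 ≤ ∑ j ∈ columnBlock n s x.2,
      (Real.sigmoid (signMatrix s γ θ x.1 j) - Real.sigmoid (A x.1 j)) ^ 2 := by
  have hΔ := le_sigmoid_sub_sigmoid_neg hγ hγ1
  have hsum : s * (γ ^ 2 / 32) ≤
      ∑ j ∈ columnBlock n s x.2, (Real.sigmoid γ - Real.sigmoid (A x.1 j)) ^ 2 +
      ∑ j ∈ columnBlock n s x.2, (Real.sigmoid (-γ) - Real.sigmoid (A x.1 j)) ^ 2 := by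
    rw [← Finset.sum_add_distrib]
    calc s * (γ ^ 2 / 32) = ∑ j ∈ columnBlock n s x.2, γ ^ 2 / 32 := by
          rw [Finset.sum_const, card_columnBlock hs hrs x.2, nsmul_eq_mul]
      _ ≤ _ := Finset.sum_le_sum fun j _ => by
          have h1 : (γ / 4) ^ 2 ≤ (Real.sigmoid γ - Real.sigmoid (-γ)) ^ 2 :=
            pow_le_pow_left₀ (by linarith) hΔ 2
          nlinarith [sq_nonneg (Real.sigmoid γ - Real.sigmoid (A x.1 j) +
            (Real.sigmoid (-γ) - Real.sigmoid (A x.1 j)))]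
  have hM : ∑ j ∈ columnBlock n s x.2,
      (Real.sigmoid (signMatrix s γ θ x.1 j) - Real.sigmoid (A x.1 j)) ^ 2 =
      ∑ j ∈ columnBlock n s x.2,
        (Real.sigmoid (if θ x then γ else -γ) - Real.sigmoid (A x.1 j)) ^ 2 :=
    Finset.sum_congr rfl fun j hj => by
      rw [signMatrix_apply hs hx (Finset.mem_filter.1 hj).2]
  rw [hM]
  cases hθ : θ x
  · simp only [hθ, Bool.false_eq_true, iff_false, not_not, decodedPositive, Set.mem_ofPred_eq,
      if_false] at h ⊢
    linarith
  · simp only [hθ, iff_true, decodedPositive, Set.mem_ofPred_eq, not_le, if_true] at h ⊢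
    linarith

lemma sum_block_le {n r s : ℕ} {f : Fin n → ℝ} (hf : ∀ j, 0 ≤ f j) :
    ∑ k : Fin r, ∑ j ∈ columnBlock n s k, f j ≤ ∑ j, f j := by
  rw [← Finset.sum_biUnion]
  · exact Finset.sum_le_sum_of_subset_of_nonneg (Finset.subset_univ _) fun j _ _ => hf j
  · intro k _ k' _ hkk
    refine Finset.disjoint_left.2 fun j hj hj' => hkk (Fin.ext ?_)
    exact (Finset.mem_filter.1 hj).2.symm.trans (Finset.mem_filter.1 hj').2

/-- The lower bound for sign matrices with `r` blocks of `s` columns: on the event, a sixteenth of the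
`(n - r * s) * r` signs are decoded wrongly, each at the cost of `s * γ ^ 2 / 64`. -/
lemma exists_mem_parameterSpace_loss_ge {n r s : ℕ} (hs : 0 < s) (hr : 0 < r) (hrs : r * s < n)
    {γ C : ℝ} (hγ : 0 ≤ γ) (hγ1 : γ ≤ 1) (hC : 0 ≤ C) (hrC : 2 * r * γ ^ 2 ≤ C ^ 2) (T : ℕ)
    (p : Fin n → Fin n → unitInterval) {q : ℝ} (hq : ∀ i j, i ≠ j → (p i j : ℝ) ≤ q)
    (hTq : T * q * s * γ ^ 2 ≤ 1 / 1024)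
    (κ : Kernel (Fin n → Fin n → ℕ) (Fin n → Fin n → ℝ)) [IsMarkovKernel κ] :
    ∃ M ∈ parameterSpace n C, (3 : ℝ) / 8 ≤ ((dataLaw T p M).bind κ).real
      {A | 1 / ((n : ℝ) ^ 2 - n) * (s * γ ^ 2 / 64 * (((n - r * s : ℕ) * r : ℝ) / 16)) ≤
        loss M (Matrix.of A)} := by
  set K : Finset (Fin n × Fin r) :=
    (Finset.univ.filter fun i : Fin n => r * s ≤ (i : ℕ)) ×ˢ Finset.univ with hK
  have hKcard : K.card = (n - r * s) * r := by
    rw [hK, Finset.card_product, card_rows, Finset.card_univ, Fintype.card_fin]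
  have hKne : K.Nonempty := Finset.card_pos.1 <| by
    rw [hKcard]; exact Nat.mul_pos (Nat.sub_pos_of_lt hrs) hr
  have : ∀ θ : Fin n × Fin r → Bool,
      IsProbabilityMeasure ((dataLaw T p (signMatrix s γ θ)).bind κ) := fun θ =>
    isProbabilityMeasure_bind κ.measurable.aemeasurable
      (Filter.Eventually.of_forall fun Y => inferInstance)
  obtain ⟨θ, hθ⟩ := exists_le_measureReal_card_errors K hKne
    (fun θ => (dataLaw T p (signMatrix s γ θ)).bind κ) (decodedPositive s γ)
    (measurableSet_decodedPositive s γ) fun θ x _ =>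
      abs_dataLaw_signMatrix_flip_le hs hrs.le hγ hγ1 T p hq hTq κ
        (measurableSet_decodedPositive s γ x) x _
  refine ⟨signMatrix s γ θ, signMatrix_mem_parameterSpace hs hγ hC hrC,
    hθ.trans (measureReal_mono ?_)⟩
  intro A hA
  simp only [Set.mem_ofPred_eq, hKcard] at hA ⊢
  rw [loss_eq]
  have hn : (1 : ℝ) ≤ n := by exact_mod_cast Nat.one_le_of_lt hrs
  refine mul_le_mul_of_nonneg_left ?_ (one_div_nonneg.2 (by nlinarith))
  calc s * γ ^ 2 / 64 * (((n - r * s : ℕ) * r : ℝ) / 16)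
      ≤ s * γ ^ 2 / 64 * ∑ x ∈ K,
          {A | ¬(A ∈ decodedPositive s γ x ↔ θ x = true)}.indicator 1 A := by
        refine mul_le_mul_of_nonneg_left ?_ (by positivity)
        exact_mod_cast hA
    _ ≤ ∑ x ∈ K, ∑ j ∈ columnBlock n s x.2,
          (Real.sigmoid (signMatrix s γ θ x.1 j) - Real.sigmoid (A x.1 j)) ^ 2 := by
        rw [Finset.mul_sum]
        refine Finset.sum_le_sum fun x hx => ?_
        by_cases h : A ∈ {A | ¬(A ∈ decodedPositive s γ x ↔ θ x = true)}
        · rw [Set.indicator_of_mem h, Pi.one_apply, mul_one]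
          refine le_blockError_of_decoding_error hs hrs.le hγ hγ1 ?_ h
          exact (Finset.mem_filter.1 (Finset.mem_product.1 hx).1).2
        · rw [Set.indicator_of_notMem h, mul_zero]
          exact Finset.sum_nonneg fun j _ => sq_nonneg _
    _ ≤ ∑ i, ∑ j, (Real.sigmoid (signMatrix s γ θ i j) - Real.sigmoid (Matrix.of A i j)) ^ 2 := by
        rw [hK, Finset.sum_product]
        have hrow : ∀ i : Fin n, ∑ k : Fin r, ∑ j ∈ columnBlock n s k,
            (Real.sigmoid (signMatrix s γ θ i j) - Real.sigmoid (A i j)) ^ 2 ≤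
              ∑ j, (Real.sigmoid (signMatrix s γ θ i j) - Real.sigmoid (A i j)) ^ 2 := fun i =>
          sum_block_le
            (f := fun j => (Real.sigmoid (signMatrix s γ θ i j) - Real.sigmoid (A i j)) ^ 2)
            fun j => sq_nonneg _
        refine (Finset.sum_le_sum fun i _ => hrow i).trans ?_
        exact Finset.sum_le_sum_of_subset_of_nonneg (Finset.subset_univ _) fun i _ _ =>
          Finset.sum_nonneg fun j _ => sq_nonneg _

end PairwiseComparison

open PairwiseComparison in
theorem theorem2 :
    ∃ (κ₃ κ₄ κ₅ : ℝ) (N : ℕ), 0 < κ₃ ∧ 0 < κ₄ ∧ 0 < κ₅ ∧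
      ∀ (T : ℕ) (c₁ c₂ : ℝ), 1 ≤ T → 0 < c₁ → 0 < c₂ →
      ∀ (n : ℕ), N < n →
      ∀ (C pₙ qₙ : ℝ), 0 < C → 12 ≤ C ^ 2 → C ^ 2 ≤ min 1 (κ₃ ^ 2 / T) * n →
        0 ≤ pₙ → pₙ ≤ qₙ → qₙ ≤ 1 → c₁ * qₙ ≤ pₙ → c₂ * (Real.log n / n) ≤ pₙ →
      ∀ (p : Fin n → Fin n → unitInterval), (∀ i j, p i j = p j i) →
        (∀ i j, i ≠ j → pₙ ≤ p i j ∧ (p i j : ℝ) ≤ qₙ) →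
      -- an arbitrary, possibly randomized, estimator: the law of its output given the data `Y`
      ∀ (estimator : Kernel (Fin n → Fin n → ℕ) (Fin n → Fin n → ℝ)) [IsMarkovKernel estimator],
      ∃ M ∈ PairwiseComparison.parameterSpace n C,
        (3 : ℝ) / 8 ≤ ((PairwiseComparison.dataLaw T p M).bind estimator).real
          {M' | min κ₄ (κ₅ * Real.sqrt (c₁ / T) * C * Real.sqrt (1 / (n * pₙ))) ≤
            PairwiseComparison.loss M (Matrix.of M')} := by
  refine ⟨1 / 32, 1 / 8192, 1 / (64 * 8192), 1, by norm_num, by norm_num, by norm_num, ?_⟩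
  intro T c₁ c₂ hT hc₁ hc₂ n hn C pₙ qₙ hC hC12 hCn _ hpq hq1 hcq hlog p _ hp κ _
  have hn1 : (1 : ℝ) < n := by exact_mod_cast hn
  have hn0 : (0 : ℝ) < n := by linarith
  have hT0 : (0 : ℝ) < T := by exact_mod_cast hT
  have hp0 : 0 < pₙ := lt_of_lt_of_le (mul_pos hc₂ (div_pos (Real.log_pos hn1) hn0)) hlog
  have hq0 : 0 < qₙ := hp0.trans_le hpq
  have hCn1 : C ^ 2 ≤ n := hCn.trans (by
    have := min_le_left (1 : ℝ) ((1 / 32) ^ 2 / T)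
    nlinarith)
  have hCn2 : C ^ 2 * T ≤ (1 / 32) ^ 2 * n := by
    have h1 : C ^ 2 ≤ (1 / 32) ^ 2 / T * n :=
      hCn.trans (mul_le_mul_of_nonneg_right (min_le_right _ _) hn0.le)
    calc C ^ 2 * (T : ℝ) ≤ (1 / 32) ^ 2 / T * n * T := by gcongr
      _ = (1 / 32) ^ 2 * (n : ℝ) := by field_simp
  -- a bound for the expected number of comparisons of one subject
  set X : ℝ := T * qₙ * n with hX
  have hX0 : 0 < X := by positivity
  set w := √X with hw
  have hw0 : 0 < w := Real.sqrt_pos.2 hX0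
  have hw2 : w ^ 2 = X := Real.sq_sqrt hX0.le
  have hCw : C * w ≤ n / 32 := by
    refine le_of_sq_le_sq ?_ (by positivity)
    rw [mul_pow, hw2, hX]
    calc C ^ 2 * (T * qₙ * n) = C ^ 2 * T * (n : ℝ) * qₙ := by ring
      _ ≤ (1 / 32) ^ 2 * n * (n : ℝ) * 1 := by gcongr
      _ = ((n : ℝ) / 32) ^ 2 := by ring
  -- `g` is `γ ^ 2`: it solves `2 * r * g = C ^ 2`, `r ≈ X * g`, up to constants, capped at `1` so
  -- that the logistic function stays in its linear range
  set g := min 1 (C / (64 * w)) with hg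
  have hg0 : 0 < g := lt_min one_pos (by positivity)
  have hg1 : g ≤ 1 := min_le_left _ _
  have hgw : g * w ≤ C / 64 := by
    calc g * w ≤ C / (64 * w) * w := by gcongr; exact min_le_right _ _
      _ = C / 64 := by field_simp
  have hγ2 : √g ^ 2 = g := Real.sq_sqrt hg0.le
  -- the least rank for which a single sign is undetectable
  set r : ℕ := ⌊512 * X * g⌋₊ + 1 with hr
  have hr1 : (r : ℝ) ≤ 512 * X * g + 1 := by
    rw [hr]; push_cast
    linarith [Nat.floor_le (show 0 ≤ 512 * X * g by positivity)]
  have hr2 : 512 * X * g ≤ r := by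
    rw [hr]; push_cast
    exact (Nat.lt_floor_add_one _).le
  have hXg : X * g ≤ n / 2048 := by
    rw [← hw2]; nlinarith
  have h2rn : 2 * r ≤ n := by
    have : (2 * r : ℝ) ≤ n := by linarith
    exact_mod_cast this
  have hr0 : 0 < r := Nat.succ_pos _
  set s : ℕ := n / (2 * r) with hs
  have hs0 : 0 < s := Nat.div_pos h2rn (by omega)
  have hsr : s * (2 * r) ≤ n := Nat.div_mul_le_self _ _
  have hsr' : n < (s + 1) * (2 * r) := by
    rw [mul_comm]; exact Nat.lt_mul_div_succ n (by omega)
  have hsrR : 2 * (r * s : ℝ) ≤ n := by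
    have : ((s * (2 * r) : ℕ) : ℝ) ≤ n := by exact_mod_cast hsr
    push_cast at this; linarith
  have hsrR' : (n : ℝ) ≤ 4 * (r * s) := by
    have h1 : (s + 1) * (2 * r) ≤ (s + s) * (2 * r) := Nat.mul_le_mul_right _ (by omega)
    have h2 : (n : ℝ) ≤ ((s + s) * (2 * r) : ℕ) := by exact_mod_cast hsr'.le.trans h1
    push_cast at h2; linarith
  have hrs : r * s < n := by
    have : (r * s : ℝ) < n := by linarith
    exact_mod_cast this
  obtain ⟨M, hM, hMl⟩ := exists_mem_parameterSpace_loss_ge (γ := √g) (C := C) (q := qₙ) hs0 hr0 hrs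
    (Real.sqrt_nonneg _) (Real.sqrt_le_one.2 hg1) hC.le
    (by
      rw [hγ2]
      have h1 : X * g * g ≤ C ^ 2 / 4096 := by
        calc X * g * g = (g * w) ^ 2 := by rw [← hw2]; ring
          _ ≤ (C / 64) ^ 2 := by gcongr
          _ = C ^ 2 / 4096 := by ring
      have h2 : (r : ℝ) * g ≤ (512 * X * g + 1) * g := by gcongr
      nlinarith)
    T p (fun i j hij => (hp i j hij).2)
    (by
      rw [hγ2]
      have h1 : 512 * X * g * s ≤ r * s := by gcongr
      have h2 : n * (1024 * (T * qₙ * s * g)) ≤ n * 1 := by rw [hX] at h1; linarith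
      have h3 := le_of_mul_le_mul_left h2 hn0
      linarith)
    κ
  refine ⟨M, hM, hMl.trans (measureReal_mono ?_)⟩
  intro A hA
  simp only [Set.mem_ofPred_eq] at hA ⊢
  refine le_trans ?_ hA
  rw [hγ2]
  -- the claimed rate is at most `g / 8192`
  have hrate : min (1 / 8192) (1 / (64 * 8192) * √(c₁ / T) * C * √(1 / (n * pₙ))) ≤ g / 8192 := by
    have h1 : √(c₁ / T) * √(1 / (n * pₙ)) ≤ 1 / w := by
      rw [← Real.sqrt_mul (by positivity), hw, ← Real.sqrt_one, ← Real.sqrt_div (by norm_num),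
        Real.sqrt_one]
      refine Real.sqrt_le_sqrt ?_
      rw [hX, div_mul_div_comm, div_le_div_iff₀ (by positivity) (by positivity)]
      have : (T * n : ℝ) * (c₁ * qₙ) ≤ T * n * pₙ := by gcongr
      linarith
    rw [hg, ← min_div_div_right (by norm_num)]
    refine min_le_min le_rfl ?_
    calc 1 / (64 * 8192) * √(c₁ / T) * C * √(1 / (n * pₙ))
        = 1 / (64 * 8192) * C * (√(c₁ / T) * √(1 / (n * pₙ))) := by ring
      _ ≤ 1 / (64 * 8192) * C * (1 / w) := by gcongr
      _ = C / (64 * w) / 8192 := by ring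
  refine hrate.trans ?_
  have hnn : 0 < (n : ℝ) ^ 2 - n := by nlinarith
  rw [one_div, inv_mul_eq_div, le_div_iff₀ hnn, Nat.cast_sub hrs.le]
  push_cast
  have h1 : (n : ℝ) / 2 * (n / 4) ≤ (n - r * s) * (r * s) :=
    mul_le_mul (by linarith) (by linarith) (by positivity) (by linarith)
  calc g / 8192 * ((n : ℝ) ^ 2 - n) ≤ g / 8192 * (n : ℝ) ^ 2 := by gcongr; linarith
    _ = g / 1024 * (n / 2 * (n / 4)) := by ring
    _ ≤ g / 1024 * ((n - r * s) * (r * s)) := by gcongr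
    _ = s * g / 64 * ((n - r * s) * r / 16) := by ring
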